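/- Let $X$ be a real Banach space and let $B_X$ be its closed unit ball. For a bounded nonempty set $C\subset X$, a functional $x^*\in X^*$ and $\delta>0$, let $S(C,x^*,\delta)=\{x\in C: x^*(x)>\sup x^*(C)-\delta\}$; such sets are the slices of $C$. A convex combination of slices of $C$ is a set $\sum_{i=1}^n\lambda_iS_i=\{\sum_{i=1}^n\lambda_i s_i: s_i\in S_i\}$, where $S_1,\dots,S_n$ are slices of $C$, $\lambda_i\ge 0$ and $\sum_{i=1}^n\lambda_i=1$. A point $x_0\in C$ is called a semi denting point (respectively a semi point of continuity (semi PC), a semi small combination of slices point (semi SCS point)) of $C$ if for every $\varepsilon>0$ there is a slice of $C$ (respectively a nonempty relatively weakly open subset of $C$, a convex combination of slices of $C$) that is contained in the closed ball of centre $x_0$ and radius $\varepsilon$. A closed subspace $Y\subset X$ is called an almost isometric ideal (ai-ideal) in $X$ if for every $\varepsilon>0$ and every finite-dimensional subspace $F\subset X$ there is a linear operator $T:F\to Y$ such that $Tu=u$ for all $u\in F\cap Y$ and $\frac{1}{1+\varepsilon}\|u\|\le\|Tu\|\le(1+\varepsilon)\|u\|$ for all $u\in F$. **Theorem.** Let $Y$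 be an ai-ideal in $X$ and let $x_0\in Y$. 1. If $x_0$ is a semi SCS point of $B_Y$, then $x_0$ is a semi SCS point of $B_X$. 2. If $x_0$ is a semi denting point of $B_Y$, then $x_0$ is a semi denting point of $B_X$. 3. If $x_0$ is a semi PC of $B_Y$, then $x_0$ is a semi PC of $B_X$. -/

import Mathlib

section SemiPoints

variable {X : Type*} [NormedAddCommGroup X] [NormedSpace ℝ X]

/-- The slice `S(C, f, δ) = {x ∈ C : f x > sup f(C) - δ}`; it is used for nonempty bounded `C`
and `δ > 0`. -/
def slice (C : Set X) (f : StrongDual ℝ X) (δ : ℝ) : Set X :=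
  {x | x ∈ C ∧ sSup (f '' C) - δ < f x}

/-- The convex combination of slices `∑ i, w i • S(C, f i, δ i)` (a Minkowski sum of sets). -/
def sliceCombination (C : Set X) {n : ℕ} (w : Fin n → ℝ) (f : Fin n → StrongDual ℝ X)
    (δ : Fin n → ℝ) : Set X :=
  {x | ∃ s : Fin n → X, (∀ i, s i ∈ slice C (f i) (δ i)) ∧ x = ∑ i, w i • s i}

/-- `x₀` is a semi denting point of the bounded set `C`. -/
def IsSemiDentingPoint (C : Set X) (x₀ : X) : Prop :=
  x₀ ∈ C ∧ ∀ ε : ℝ, 0 < ε → ∃ (f : StrongDual ℝ X) (δ : ℝ), 0 < δ ∧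
    slice C f δ ⊆ Metric.closedBall x₀ ε

/-- `x₀` is a semi point of continuity (semi PC) of the bounded set `C`: every ball around `x₀`
contains a nonempty relatively weakly open subset of `C`. -/
def IsSemiPC (C : Set X) (x₀ : X) : Prop :=
  x₀ ∈ C ∧ ∀ ε : ℝ, 0 < ε → ∃ U : Set (WeakSpace ℝ X), IsOpen U ∧
    (C ∩ toWeakSpace ℝ X ⁻¹' U).Nonempty ∧
    C ∩ toWeakSpace ℝ X ⁻¹' U ⊆ Metric.closedBall x₀ ε

/-- `x₀` is a semi small combination of slices point (semi SCS point) of the bounded set `C`. -/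
def IsSemiSCSPoint (C : Set X) (x₀ : X) : Prop :=
  x₀ ∈ C ∧ ∀ ε : ℝ, 0 < ε → ∃ (n : ℕ) (w : Fin n → ℝ) (f : Fin n → StrongDual ℝ X)
    (δ : Fin n → ℝ), (∀ i, 0 ≤ w i) ∧ ∑ i, w i = 1 ∧ (∀ i, 0 < δ i) ∧
    sliceCombination C w f δ ⊆ Metric.closedBall x₀ ε

/-- The closed subspace `Y` is an almost isometric ideal (ai-ideal) in `X`. -/
def IsAlmostIsometricIdeal (Y : Submodule ℝ X) : Prop :=
  IsClosed (Y : Set X) ∧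
  ∀ ε : ℝ, 0 < ε → ∀ F : Submodule ℝ X, FiniteDimensional ℝ F →
    ∃ T : F →ₗ[ℝ] Y,
      (∀ u : F, (u : X) ∈ Y → (T u : X) = (u : X)) ∧
      ∀ u : F, 1 / (1 + ε) * ‖u‖ ≤ ‖T u‖ ∧ ‖T u‖ ≤ (1 + ε) * ‖u‖

end SemiPoints

/-! The local operators of an ai-ideal combine into maps `R a : X → Y` that do not increase norms,
preserve them in the limit and tend to the identity on `Y`. Limits of `f ∘ R a` extend each
functional `f` on `Y` to `φ f` on `X`. If `x` lies in the set cut from `B_X` by the extended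
functionals, `R a x` eventually lies in the original small subset of `B_Y`, hence within `ε` of
`x₀`; asymptotic isometry returns this bound to `x`. -/

open Filter Topology in
/-- An almost isometric ideal `Y` of `X` is the range of a net of linear maps which are
asymptotically contractive, isometric, and the identity on `Y`. -/
theorem IsAlmostIsometricIdeal.exists_net {X : Type*} [NormedAddCommGroup X] [NormedSpace ℝ X]
    {Y : Submodule ℝ X} (hY : IsAlmostIsometricIdeal Y) :
    ∃ (l : Ultrafilter (Finset X × ℕ)) (R : Finset X × ℕ → X →ₗ[ℝ] Y),
      (∀ x, ∀ᶠ a in (l : Filter (Finset X × ℕ)), ‖R a x‖ ≤ ‖x‖) ∧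
      (∀ x, Tendsto (fun a => ‖R a x‖) l (𝓝 ‖x‖)) ∧
      (∀ y : Y, Tendsto (fun a => R a y) l (𝓝 y)) := by
  classical
  let e : Finset X × ℕ → ℝ := fun a => 1 / ((a.2 : ℝ) + 1)
  have he : ∀ a, 0 < e a := fun a => by positivity
  have key : ∀ a : Finset X × ℕ, ∃ T : X →ₗ[ℝ] Y, ∀ u ∈ Submodule.span ℝ (a.1 : Set X),
      (u ∈ Y → (T u : X) = u) ∧ 1 / (1 + e a) * ‖u‖ ≤ ‖T u‖ ∧ ‖T u‖ ≤ (1 + e a) * ‖u‖ := by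
    intro a
    obtain ⟨T, hT, hT'⟩ := hY.2 (e a) (he a) (Submodule.span ℝ (a.1 : Set X))
      (FiniteDimensional.span_finset ℝ a.1)
    obtain ⟨S, hS⟩ := LinearMap.exists_extend T
    refine ⟨S, fun u hu => ?_⟩
    have hSu : S u = T ⟨u, hu⟩ := LinearMap.congr_fun hS ⟨u, hu⟩
    rw [hSu]
    exact ⟨fun h => hT ⟨u, hu⟩ h, hT' ⟨u, hu⟩⟩
  choose T hT using key
  -- An ultrafilter lets the bounded scalars `f (R a x)` converge for all `f` and `x` at once.
  let l : Ultrafilter (Finset X × ℕ) := Ultrafilter.of atTop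
  have hl : (l : Filter (Finset X × ℕ)) ≤ atTop := Ultrafilter.of_le _
  have hmem : ∀ x : X, ∀ᶠ a in (l : Filter (Finset X × ℕ)),
      x ∈ Submodule.span ℝ (a.1 : Set X) := fun x => hl <| by
    filter_upwards [eventually_ge_atTop (({x} : Finset X), 0)] with a ha
    exact Submodule.subset_span (ha.1 (Finset.mem_singleton_self x))
  have he0 : Tendsto e l (𝓝 0) := by
    have h : Tendsto (Prod.snd : Finset X × ℕ → ℕ) atTop atTop := by
      rw [← prod_atTop_atTop_eq]; exact tendsto_snd
    exact ((tendsto_one_div_add_atTop_nhds_zero_nat (𝕜 := ℝ)).comp h).mono_left hl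
  have hc : Tendsto (fun a => (1 + e a)⁻¹) l (𝓝 1) := by
    simpa using (he0.const_add 1).inv₀ (by norm_num)
  -- Rescaling keeps images of points of `B_X` in `B_Y`; the price is that `y ∈ Y` is fixed only in
  -- the limit.
  have hle : ∀ x, ∀ᶠ a in (l : Filter (Finset X × ℕ)), ‖((1 + e a)⁻¹ • T a) x‖ ≤ ‖x‖ := by
    intro x
    filter_upwards [hmem x] with a ha
    have h1 : 0 < 1 + e a := by linarith [he a]
    rw [LinearMap.smul_apply, norm_smul, Real.norm_of_nonneg (inv_pos.2 h1).le,
      inv_mul_le_iff₀ h1]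
    exact (hT a x ha).2.2
  refine ⟨l, fun a => (1 + e a)⁻¹ • T a, hle, fun x => ?_, fun y => ?_⟩
  · refine tendsto_of_tendsto_of_tendsto_of_le_of_le'
      (g := fun a => (1 + e a)⁻¹ * ((1 + e a)⁻¹ * ‖x‖)) ?_ tendsto_const_nhds ?_ (hle x)
    · simpa using hc.mul (hc.mul_const ‖x‖)
    · filter_upwards [hmem x] with a ha
      have h1 : 0 < 1 + e a := by linarith [he a]
      rw [LinearMap.smul_apply, norm_smul, Real.norm_of_nonneg (inv_pos.2 h1).le]
      have := (hT a x ha).2.1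
      rw [one_div] at this
      gcongr
  · have h : Tendsto (fun a => (1 + e a)⁻¹ • y) l (𝓝 y) := by
      simpa using hc.smul_const y
    refine h.congr' ?_
    filter_upwards [hmem y] with a ha
    rw [LinearMap.smul_apply, Subtype.ext ((hT a y ha).1 y.2)]

open Filter Topology in
/-- Functionals on `Y` transfer to `X` along an asymptotically contractive net of linear maps. -/
theorem exists_strongDual_tendsto_comp {X Y ι : Type*} [NormedAddCommGroup X] [NormedSpace ℝ X]
    [NormedAddCommGroup Y] [NormedSpace ℝ Y] (l : Ultrafilter ι) (R : ι → X →ₗ[ℝ] Y)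
    (hR : ∀ x, ∀ᶠ a in (l : Filter ι), ‖R a x‖ ≤ ‖x‖) (f : StrongDual ℝ Y) :
    ∃ g : StrongDual ℝ X, ∀ x, Tendsto (fun a => f (R a x)) l (𝓝 (g x)) := by
  have hbound : ∀ x, ∀ᶠ a in (l : Filter ι), f (R a x) ∈ Metric.closedBall 0 (‖f‖ * ‖x‖) := by
    intro x
    filter_upwards [hR x] with a ha
    rw [mem_closedBall_zero_iff]
    exact (f.le_opNorm _).trans (by gcongr)
  have hlim : ∀ x, ∃ r ∈ Metric.closedBall (0 : ℝ) (‖f‖ * ‖x‖),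
      Tendsto (fun a => f (R a x)) l (𝓝 r) := fun x =>
    (isCompact_closedBall (0 : ℝ) (‖f‖ * ‖x‖)).ultrafilter_le_nhds
      (l.map fun a => f (R a x)) (le_principal_iff.2 (hbound x))
  choose g hg hlim using hlim
  refine ⟨LinearMap.mkContinuous ⟨⟨g, fun x y => ?_⟩, fun c x => ?_⟩ ‖f‖
    fun x => mem_closedBall_zero_iff.1 (hg x), hlim⟩
  · refine tendsto_nhds_unique (hlim (x + y)) ?_
    simpa using (hlim x).add (hlim y)
  · refine tendsto_nhds_unique (hlim (c • x)) ?_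
    simpa using (hlim x).const_mul c

open Filter Topology in
/-- If `g` extends `f` and is a pointwise limit of `f ∘ R a`, then the points of a slice of the unit
ball given by `g` are eventually mapped into the corresponding slice given by `f`. -/
theorem eventually_mem_slice {X ι : Type*} [NormedAddCommGroup X] [NormedSpace ℝ X]
    {Y : Submodule ℝ X} {l : Filter ι} {R : ι → X →ₗ[ℝ] Y}
    (hR : ∀ x, ∀ᶠ a in l, ‖R a x‖ ≤ ‖x‖) {f : StrongDual ℝ Y} {g : StrongDual ℝ X}
    (hg : ∀ x, Tendsto (fun a => f (R a x)) l (𝓝 (g x))) (hgf : ∀ y : Y, g y = f y)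
    {δ : ℝ} {x : X} (hx : x ∈ slice (Metric.closedBall (0 : X) 1) g δ) :
    ∀ᶠ a in l, R a x ∈ slice (Metric.closedBall (0 : Y) 1) f δ := by
  -- As `B_Y ⊆ B_X` and `g` extends `f`, the same `δ` gives `g` a threshold at least as high.
  have hsup : sSup (f '' Metric.closedBall (0 : Y) 1) ≤ sSup (g '' Metric.closedBall (0 : X) 1) := by
    refine csSup_le_csSup ⟨‖g‖, ?_⟩ ⟨f 0, 0, by simp, rfl⟩ ?_
    · rintro _ ⟨z, hz, rfl⟩
      exact (le_abs_self _).trans (g.unit_le_opNorm z (mem_closedBall_zero_iff.1 hz))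
    · rintro _ ⟨y, hy, rfl⟩
      exact ⟨y, by simpa using hy, hgf y⟩
  have hlt : sSup (f '' Metric.closedBall (0 : Y) 1) - δ < g x := by linarith [hx.2]
  filter_upwards [hR x, (hg x).eventually_const_lt hlt] with a h1 h2
  exact ⟨mem_closedBall_zero_iff.2 (h1.trans (mem_closedBall_zero_iff.1 hx.1)), h2⟩

-- `‖x - x₀‖` is the limit of `‖R a x - R a x₀‖`, and `R a x₀` tends to `x₀`.
open Filter Topology in
theorem mem_closedBall_of_eventually_map_mem {X ι : Type*} [NormedAddCommGroup X]
    [NormedSpace ℝ X] {Y : Submodule ℝ X} {l : Filter ι} [l.NeBot] {R : ι → X →ₗ[ℝ] Y}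
    (hR : ∀ x, Tendsto (fun a => ‖R a x‖) l (𝓝 ‖x‖)) {x₀ : Y}
    (hx₀ : Tendsto (fun a => R a x₀) l (𝓝 x₀)) {ε : ℝ} {x : X}
    (hx : ∀ᶠ a in l, R a x ∈ Metric.closedBall x₀ ε) :
    x ∈ Metric.closedBall (x₀ : X) ε := by
  rw [mem_closedBall_iff_norm]
  have h : Tendsto (fun a => ε + ‖R a x₀ - x₀‖) l (𝓝 ε) := by
    simpa using (tendsto_iff_norm_sub_tendsto_zero.1 hx₀).const_add ε
  refine le_of_tendsto_of_tendsto (hR (x - x₀)) h ?_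
  filter_upwards [hx] with a ha
  rw [mem_closedBall_iff_norm] at ha
  calc ‖R a (x - x₀)‖ = ‖(R a x - x₀) - (R a x₀ - x₀)‖ := by rw [map_sub]; congr 1; abel
    _ ≤ ‖R a x - x₀‖ + ‖R a x₀ - x₀‖ := norm_sub_le _ _
    _ ≤ ε + ‖R a x₀ - x₀‖ := by gcongr

open Filter Topology in
theorem mainTheorem9 {X : Type*} [NormedAddCommGroup X] [NormedSpace ℝ X] [CompleteSpace X]
    (Y : Submodule ℝ X) (hY : IsAlmostIsometricIdeal Y) (x₀ : Y) :
    (IsSemiSCSPoint (Metric.closedBall (0 : Y) 1) x₀ →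
      IsSemiSCSPoint (Metric.closedBall (0 : X) 1) (x₀ : X)) ∧
    (IsSemiDentingPoint (Metric.closedBall (0 : Y) 1) x₀ →
      IsSemiDentingPoint (Metric.closedBall (0 : X) 1) (x₀ : X)) ∧
    (IsSemiPC (Metric.closedBall (0 : Y) 1) x₀ →
      IsSemiPC (Metric.closedBall (0 : X) 1) (x₀ : X)) := by
  obtain ⟨l, R, hle, hnorm, hid⟩ := hY.exists_net
  choose φ hφ using exists_strongDual_tendsto_comp l R hle
  have hφY : ∀ f (y : Y), φ f y = f y := fun f y =>
    tendsto_nhds_unique (hφ f y) ((f.continuous.tendsto y).comp (hid y))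
  have hball : x₀ ∈ Metric.closedBall (0 : Y) 1 → (x₀ : X) ∈ Metric.closedBall (0 : X) 1 :=
    fun h => by simpa using h
  refine ⟨fun ⟨h₀, h⟩ => ⟨hball h₀, fun ε hε => ?_⟩, fun ⟨h₀, h⟩ => ⟨hball h₀, fun ε hε => ?_⟩,
    fun ⟨h₀, h⟩ => ⟨hball h₀, fun ε hε => ?_⟩⟩
  · obtain ⟨n, w, f, δ, hw, hw1, hδ, hsub⟩ := h ε hε
    refine ⟨n, w, fun i => φ (f i), δ, hw, hw1, hδ, ?_⟩
    rintro _ ⟨s, hs, rfl⟩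
    refine mem_closedBall_of_eventually_map_mem hnorm (hid x₀) ?_
    filter_upwards [eventually_all.2 fun i =>
      eventually_mem_slice hle (hφ (f i)) (hφY (f i)) (hs i)] with a ha
    exact hsub ⟨fun i => R a (s i), ha, by simp⟩
  · obtain ⟨f, δ, hδ, hsub⟩ := h ε hε
    refine ⟨φ f, δ, hδ, fun x hx => mem_closedBall_of_eventually_map_mem hnorm (hid x₀) ?_⟩
    filter_upwards [eventually_mem_slice hle (hφ f) (hφY f) hx] with a ha
    exact hsub ha
  · obtain ⟨U, hU, ⟨y, hy, hyU⟩, hsub⟩ := h ε hε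
    obtain ⟨W, hW, rfl⟩ := isOpen_induced_iff.1 hU
    -- The weak topology of `Y` is induced from the product over all `f`, so replacing each `f` by
    -- `φ f` pulls the same `W` back to `X`.
    refine ⟨{z | (fun f => φ f ((toWeakSpace ℝ X).symm z)) ∈ W}, ?_, ⟨y, by simpa using hy, ?_⟩, ?_⟩
    · exact hW.preimage (continuous_pi fun f => WeakBilin.eval_continuous _ (φ f))
    · change (fun f => φ f (y : X)) ∈ W
      simp only [hφY]
      exact hyU
    · rintro x ⟨hx, hxW⟩
      refine mem_closedBall_of_eventually_map_mem hnorm (hid x₀) ?_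
      have hlim : Tendsto (fun a => fun f : StrongDual ℝ Y => f (R a x)) l
          (𝓝 fun f => φ f x) := tendsto_pi_nhds.2 fun f => hφ f x
      filter_upwards [hle x, hlim.eventually (hW.mem_nhds hxW)] with a h1 h2
      exact hsub ⟨mem_closedBall_zero_iff.2 (h1.trans (mem_closedBall_zero_iff.1 hx)), h2⟩
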